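/- For $n\ge 1$ let $P_n^3$ denote the loose $3$-uniform hyperpath with $n$ edges, i.e. the hypergraph with vertex set $\{v_1,\dots,v_{2n+1}\}$ and edges $e_j=\{v_{2j-1},v_{2j},v_{2j+1}\}$ for $1\le j\le n$. Its adjacency hypermatrix $A$ has entries $A_{abc}=\tfrac12$ if $\{v_a,v_b,v_c\}$ is an edge and $A_{abc}=0$ otherwise, and its nullvariety is the affine algebraic variety $V_0=\{x\in\mathbb{C}^{2n+1} : \nabla\big(\sum_{a,b,c}A_{abc}\,x_ax_bx_c\big)=0\}$ (containing the origin). Then for every $n\ge 3$ the variety $V_0$ has dimension $2\lfloor n/2\rfloor+1$, where the dimension of an affine variety is the Krull dimension of its coordinate ring. -/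

import Mathlib

open MvPolynomial

/-- A `k`-uniform hypergraph with vertex set the whole type `V`: every edge has exactly `k`
elements. -/
structure UniformHypergraph (V : Type*) (k : ℕ) extends Hypergraph V where
  vertexSet_eq : vertexSet = Set.univ
  encard_eq : ∀ e ∈ edgeSet, e.encard = k

/-- A cubical complex hypermatrix of order `k` with index set `ι`. -/
abbrev Hypermatrix (ι : Type*) (k : ℕ) : Type _ := (Fin k → ι) → ℂ

namespace Hypermatrix

variable {ι : Type*} {k : ℕ}

open Classical in
/-- The identity hypermatrix: `1` at `(i₁, …, i_k)` if `i₁ = ⋯ = i_k`, and `0` otherwise. -/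
noncomputable def ident (ι : Type*) (k : ℕ) : Hypermatrix ι k :=
  fun i => if ∀ a b, i a = i b then 1 else 0

/-- The homogeneous `k`-form `M x^k = ∑ M_{i₁ ⋯ i_k} x_{i₁} ⋯ x_{i_k}`, as a polynomial. -/
noncomputable def form [Fintype ι] (M : Hypermatrix ι k) : MvPolynomial ι ℂ :=
  ∑ i : Fin k → ι, C (M i) * ∏ j : Fin k, X (i j)

/-- The `l`-eigenvariety: all `x ∈ ℂ^ι` at which the gradient of the form `(M - l I) x^k`
vanishes. As an affine variety it contains the origin besides the eigenvectors. -/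
def eigenvariety [Fintype ι] (M : Hypermatrix ι k) (l : ℂ) : Set (ι → ℂ) :=
  {x | ∀ v : ι, eval x (pderiv v (form (M - l • ident ι k))) = 0}

/-- The nullvariety is the `0`-eigenvariety. -/
def nullvariety [Fintype ι] (M : Hypermatrix ι k) : Set (ι → ℂ) :=
  eigenvariety M 0

end Hypermatrix

namespace UniformHypergraph

variable {V : Type*} {k : ℕ}

open Classical in
/-- The adjacency hypermatrix: its `(v₁, …, v_k)` entry is `1/(k-1)!` if `{v₁, …, v_k}` is an
edge, and `0` otherwise. -/
noncomputable def adjacency (H : UniformHypergraph V k) : Hypermatrix V k :=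
  fun v => if Set.range v ∈ H.edgeSet then 1 / ((k - 1).factorial : ℂ) else 0

/-- The nullvariety of a hypergraph is the nullvariety of its adjacency hypermatrix. -/
noncomputable def nullvariety [Fintype V] (H : UniformHypergraph V k) : Set (V → ℂ) :=
  H.adjacency.nullvariety

end UniformHypergraph

/-- The `i`-th vertex of the `j`-th edge of the loose hyperpath, everything counted from `0`. -/
def looseHyperpathVertex (k n : ℕ) (j : Fin n) (i : Fin k) : Fin ((k - 1) * n + 1) :=
  ⟨(k - 1) * j + i, by
    have h1 : (k - 1) * ((j : ℕ) + 1) ≤ (k - 1) * n := Nat.mul_le_mul_left _ j.isLt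
    rw [Nat.mul_add, Nat.mul_one] at h1
    have h2 := i.isLt
    omega⟩

/-- The loose hyperpath `P_n^k` (for `k ≥ 2`): the vertices are `0, 1, …, (k-1)n`, and the edges
are the `n` sets `{(k-1)j, (k-1)j+1, …, (k-1)(j+1)}` for `0 ≤ j < n`. -/
def looseHyperpath (k n : ℕ) : UniformHypergraph (Fin ((k - 1) * n + 1)) k where
  vertexSet := Set.univ
  edgeSet := Set.range fun j : Fin n => Set.range (looseHyperpathVertex k n j)
  subset_vertexSet_of_mem_edgeSet' _ _ := Set.subset_univ _
  vertexSet_eq := rfl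
  encard_eq := by
    rintro _ ⟨j, rfl⟩
    have h : Function.Injective (looseHyperpathVertex k n j) := by
      intro a b hab
      have := congrArg Fin.val hab
      simp only [looseHyperpathVertex] at this
      exact Fin.ext (by omega)
    change (Set.range (looseHyperpathVertex k n j)).encard = k
    rw [← Set.image_univ, h.encard_image]
    simp

/-- The dimension of an affine algebraic set `Z ⊆ ℂ^ι`: the Krull dimension of its coordinate
ring `ℂ[x]/I(Z)`. -/
noncomputable def affineDim {ι : Type*} (Z : Set (ι → ℂ)) : WithBot ℕ∞ :=
  ringKrullDim (MvPolynomial ι ℂ ⧸ vanishingIdeal ℂ Z)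

/-! Write `y 0, …, y n` for the coordinates at even vertices and `z j` for the one at the middle of
edge `j`, which joins `j` to `j + 1`. The gradient vanishes iff `y j * y (j + 1) = 0` and `y (j - 1)
* z (j - 1) + z j * y (j + 1) = 0`, with absent terms read as zero. On an irreducible piece the
support `S` of `y` is an independent set of the path `0, …, n`, and each neighbour of `S` gives one
linear relation among the `z j`. These relations are independent, so the piece has dimension `|S| +
n - |N(S)|`. A matching of the path bounds `|S| - |N(S)|` by 1 for even `n` and by 0 for odd `n`.

The upper bound is carried out for a solution in any domain over `ℂ`
(`IsLoosePathNull.exists_finset_isAlgebraic`). The lower bound uses polynomial parametrisations: `S`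
empty for odd `n`, `S` all even indices for even `n`. -/

/-! ### Krull dimension and transcendence degree -/

/-- The Krull dimension is unchanged under injective integral extensions. -/
theorem ringKrullDim_eq_of_isIntegral_of_injective {R S : Type*} [CommRing R] [CommRing S]
    [Algebra R S] [Algebra.IsIntegral R S] (h : Function.Injective (algebraMap R S)) :
    ringKrullDim S = ringKrullDim R := by
  apply le_antisymm
  -- Incomparability: contraction of primes preserves strict inclusions. The other inequality is
  -- lying over followed by going up.
  · refine Order.krullDim_le_of_strictMono (PrimeSpectrum.comap (algebraMap R S)) ?_
    intro p q hpq
    exact Ideal.IsIntegral.comap_lt_comap (R := R) (I := p.asIdeal) (J := q.asIdeal) hpq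
  · refine iSup_le fun l => ?_
    obtain ⟨P, _, hP⟩ := Ideal.exists_ideal_over_prime_of_isIntegral (S := S) l.head.asIdeal ⊥
      (by
        intro x hx
        have hx' : algebraMap R S x = 0 := by simpa using hx
        rw [(injective_iff_map_eq_zero _).1 h x hx']
        exact zero_mem _)
    have hP1 : P.IsPrime := hP.1
    have : P.LiesOver l.head.asIdeal := ⟨hP.2.symm⟩
    obtain ⟨L, hL, -⟩ := Ideal.exists_ltSeries_of_hasGoingUp (S := S) l P
    rw [← hL]
    exact Order.LTSeries.length_le_krullDim L

/-- The Krull dimension of a finitely generated domain over a field is its transcendence degree. -/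
theorem exists_ringKrullDim_eq_and_trdeg_eq (k R : Type*) [Field k] [CommRing R] [IsDomain R]
    [Algebra k R] [Algebra.FiniteType k R] :
    ∃ s : ℕ, ringKrullDim R = s ∧ Algebra.trdeg k R = s := by
  obtain ⟨s, g, hg, hint⟩ := exists_integral_inj_algHom_of_fg k R
  refine ⟨s, ?_, ?_⟩
  · let _ := g.toRingHom.toAlgebra
    have : Algebra.IsIntegral (MvPolynomial (Fin s) k) R := ⟨hint⟩
    rw [ringKrullDim_eq_of_isIntegral_of_injective (R := MvPolynomial (Fin s) k) (S := R) hg,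
      MvPolynomial.ringKrullDim_of_isNoetherianRing, ringKrullDim_eq_zero_of_field]
    simp
  · let _ := g.toRingHom.toAlgebra
    have : Algebra.IsIntegral (MvPolynomial (Fin s) k) R := ⟨hint⟩
    have : IsScalarTower k (MvPolynomial (Fin s) k) R :=
      IsScalarTower.of_algebraMap_eq fun x => (g.commutes x).symm
    have : FaithfulSMul (MvPolynomial (Fin s) k) R :=
      (faithfulSMul_iff_algebraMap_injective _ _).2 hg
    have h := lift_trdeg_add_eq k (MvPolynomial (Fin s) k) R
    rw [trdeg_eq_zero (R := MvPolynomial (Fin s) k)] at h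
    simpa [eq_comm] using h

/-- A chain of primes lies above its smallest member `P`, so it is already a chain in `R ⧸ P`. This
reduces dimension bounds to domains. -/
theorem ringKrullDim_le_of_forall_isPrime {R : Type*} [CommRing R] {d : WithBot ℕ∞}
    (h : ∀ P : Ideal R, P.IsPrime → ringKrullDim (R ⧸ P) ≤ d) : ringKrullDim R ≤ d := by
  refine iSup_le fun l => ?_
  refine le_trans ?_ (h l.head.asIdeal l.head.isPrime)
  rw [ringKrullDim_quotient]
  have hmem (i) : l i ∈ PrimeSpectrum.zeroLocus (R := R) l.head.asIdeal := by
    have : l.head ≤ l i := LTSeries.head_le l i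
    exact this
  let l' : LTSeries (PrimeSpectrum.zeroLocus (R := R) l.head.asIdeal) :=
    ⟨l.length, fun i => ⟨l i, hmem i⟩, fun i => l.step i⟩
  exact Order.LTSeries.length_le_krullDim l'

/-- If `ℂ[x]` maps to a polynomial ring in such a way that the target is algebraic over the image
and the induced point map has values in `Z`, then `Z` has at least the dimension of the target. -/
theorem natCard_le_affineDim {ι σ : Type} [Finite ι] [Finite σ] (Z : Set (ι → ℂ))
    (x : ι → MvPolynomial σ ℂ) (hZ : ∀ w : σ → ℂ, (fun i => eval w (x i)) ∈ Z)
    (halg : ∀ s : σ, IsAlgebraic (aeval (R := ℂ) x).range (X s : MvPolynomial σ ℂ)) :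
    (Nat.card σ : WithBot ℕ∞) ≤ affineDim Z := by
  set φ := aeval (R := ℂ) x
  -- A polynomial vanishing on `Z` pulls back to one vanishing at every point of `ℂ^σ`, hence to
  -- zero. So the coordinate ring surjects onto the image of `φ`.
  have hker : vanishingIdeal ℂ Z ≤ RingHom.ker φ.rangeRestrict := by
    intro p hp
    rw [RingHom.mem_ker]
    apply Subtype.ext
    apply MvPolynomial.funext
    intro w
    have := (mem_vanishingIdeal_iff.1 hp) _ (hZ w)
    change eval w (aeval x p) = eval w 0
    rw [map_zero, ← this]
    exact MvPolynomial.comp_aeval_apply (f := x) (aeval w) p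
  have hle : ringKrullDim φ.range ≤ affineDim Z :=
    ringKrullDim_le_of_surjective
      (Ideal.Quotient.lift (vanishingIdeal ℂ Z) φ.rangeRestrict.toRingHom hker)
      (Ideal.Quotient.lift_surjective_of_surjective _ _ φ.rangeRestrict_surjective)
  refine le_trans ?_ hle
  have : Algebra.FiniteType ℂ φ.range :=
    Algebra.FiniteType.of_surjective φ.rangeRestrict φ.rangeRestrict_surjective
  obtain ⟨s, hs, ht⟩ := exists_ringKrullDim_eq_and_trdeg_eq ℂ φ.range
  have hA : Algebra.IsAlgebraic φ.range (MvPolynomial σ ℂ) := by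
    let T := (Subalgebra.algebraicClosure φ.range (MvPolynomial σ ℂ)).restrictScalars ℂ
    have : T = ⊤ := by
      rw [eq_top_iff, ← MvPolynomial.adjoin_range_X, Algebra.adjoin_le_iff]
      rintro _ ⟨s, rfl⟩
      exact halg s
    refine ⟨fun a => ?_⟩
    have ha : a ∈ T := this ▸ Algebra.mem_top
    exact ha
  have h := trdeg_add_eq ℂ φ.range (A := MvPolynomial σ ℂ)
  rw [trdeg_eq_zero (R := φ.range), ht, MvPolynomial.trdeg_of_isDomain] at h
  rw [hs]
  have : Fintype σ := Fintype.ofFinite σ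
  simp at h
  rw [h]
  simp

/-- If the coordinates of every solution of the equations of `Z` in a domain over `ℂ` are algebraic
over at most `d` elements, then `Z` has dimension at most `d`. -/
theorem affineDim_le {ι : Type} [Finite ι] (Z : Set (ι → ℂ))
    (d : ℕ) (h : ∀ (R : Type) [CommRing R] [IsDomain R] [Algebra ℂ R] (x : ι → R),
      (∀ p ∈ vanishingIdeal ℂ Z, aeval x p = 0) → ∃ s : Finset R, s.card ≤ d ∧
      ∀ i, IsAlgebraic (Algebra.adjoin ℂ (s : Set R)) (x i)) :
    affineDim Z ≤ d := by
  refine ringKrullDim_le_of_forall_isPrime fun P _ => ?_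
  set R := (MvPolynomial ι ℂ ⧸ vanishingIdeal ℂ Z) ⧸ P
  let φ : MvPolynomial ι ℂ →ₐ[ℂ] R :=
    (Ideal.Quotient.mkₐ ℂ P).comp (Ideal.Quotient.mkₐ ℂ (vanishingIdeal ℂ Z))
  have hφ : Function.Surjective φ :=
    (Ideal.Quotient.mkₐ_surjective ℂ P).comp (Ideal.Quotient.mkₐ_surjective ℂ _)
  have hx : aeval (fun i => φ (X i)) = φ := (MvPolynomial.aeval_unique φ).symm
  obtain ⟨s, hs, halg⟩ := h R (fun i => φ (X i)) (by
    intro p hp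
    rw [hx]
    change Ideal.Quotient.mk P (Ideal.Quotient.mk _ p) = 0
    rw [Ideal.Quotient.eq_zero_iff_mem.2 hp, map_zero])
  have hA : Algebra.IsAlgebraic (Algebra.adjoin ℂ (s : Set R)) R := by
    let T := (Subalgebra.algebraicClosure (Algebra.adjoin ℂ (s : Set R)) R).restrictScalars ℂ
    have : T = ⊤ := by
      rw [eq_top_iff, ← (AlgHom.range_eq_top φ).2 hφ, ← hx, ← Algebra.adjoin_range_eq_range_aeval,
        Algebra.adjoin_le_iff]
      rintro _ ⟨i, rfl⟩
      exact halg i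
    refine ⟨fun a => ?_⟩
    have ha : a ∈ T := this ▸ Algebra.mem_top
    exact ha
  have : Algebra.FiniteType ℂ R := Algebra.FiniteType.of_surjective φ hφ
  obtain ⟨m, hm, ht⟩ := exists_ringKrullDim_eq_and_trdeg_eq ℂ R
  have h1 := Algebra.IsAlgebraic.trdeg_le_cardinalMk ℂ (s : Set R)
  rw [ht] at h1
  rw [hm]
  have h2 : m ≤ s.card := by simpa using h1
  exact_mod_cast h2.trans hs

/-! ### The equations of the nullvariety -/

theorem looseHyperpathVertex_injective (k n : ℕ) (j : Fin n) :
    Function.Injective (looseHyperpathVertex k n j) := by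
  intro a b hab
  have := congrArg Fin.val hab
  simp only [looseHyperpathVertex] at this
  exact Fin.ext (by omega)

/-- The middle vertex of an edge lies in no other edge. -/
theorem range_looseHyperpathVertex_injective (n : ℕ) :
    Function.Injective fun j : Fin n => Set.range (looseHyperpathVertex 3 n j) := by
  intro j j' h
  have h0 : looseHyperpathVertex 3 n j 1 ∈ Set.range (looseHyperpathVertex 3 n j') := by
    rw [← show Set.range _ = Set.range _ from h]
    exact Set.mem_range_self 1
  obtain ⟨i, hi⟩ := h0
  have hv := congrArg Fin.val hi
  simp only [looseHyperpathVertex, Fin.val_one] at hv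
  have := i.isLt
  exact Fin.ext (by omega)

/-- The cubic form of the loose hyperpath is `3` times the sum of the edge monomials. -/
theorem form_looseHyperpath (n : ℕ) :
    Hypermatrix.form ((looseHyperpath 3 n).adjacency - (0 : ℂ) • Hypermatrix.ident _ 3) =
      ∑ j : Fin n, C 3 * ∏ i : Fin 3, X (looseHyperpathVertex 3 n j i) := by
  classical
  rw [zero_smul, sub_zero, Hypermatrix.form]
  let e : Fin n × Equiv.Perm (Fin 3) → Fin 3 → Fin ((3 - 1) * n + 1) :=
    fun p => looseHyperpathVertex 3 n p.1 ∘ p.2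
  have he (p) : Set.range (e p) = Set.range (looseHyperpathVertex 3 n p.1) := by
    simp [e, Set.range_comp]
  have hmem (p) : Set.range (e p) ∈ (looseHyperpath 3 n).edgeSet := ⟨p.1, (he p).symm⟩
  -- Only orderings of edges contribute; each edge has `3! = 6` of them with coefficient `1/2`,
  -- whence the factor 3.
  have key : ∑ p : Fin n × Equiv.Perm (Fin 3),
      (C ((looseHyperpath 3 n).adjacency (e p)) * ∏ i, X (e p i) :
        MvPolynomial (Fin ((3 - 1) * n + 1)) ℂ) =
      ∑ i, C ((looseHyperpath 3 n).adjacency i) * ∏ j, X (i j) := by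
    refine Finset.sum_of_injOn e ?_ (by simp) ?_ (fun _ _ => rfl)
    · rintro ⟨j, s⟩ - ⟨j', s'⟩ - h
      have hj : j = j' := range_looseHyperpathVertex_injective n (by
        change Set.range _ = Set.range _
        rw [← he (j, s), ← he (j', s'), h])
      subst hj
      congr 1
      ext i : 1
      exact looseHyperpathVertex_injective 3 n j (congrFun h i)
    · intro v _ hv
      have : Set.range v ∉ (looseHyperpath 3 n).edgeSet := by
        rintro ⟨j, hj⟩
        apply hv
        have hj' : Set.range (looseHyperpathVertex 3 n j) = Set.range v := hj
        have hs (i : Fin 3) : ∃ i', looseHyperpathVertex 3 n j i' = v i := by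
          rw [← Set.mem_range, hj']
          exact Set.mem_range_self i
        choose s hs using hs
        have hsurj : Function.Surjective s := by
          intro i
          have : looseHyperpathVertex 3 n j i ∈ Set.range v := hj' ▸ Set.mem_range_self i
          obtain ⟨i', hi'⟩ := this
          exact ⟨i', looseHyperpathVertex_injective 3 n j ((hs i').trans hi')⟩
        refine ⟨(j, Equiv.ofBijective s (Finite.injective_iff_bijective.1
          (Finite.injective_iff_surjective.2 hsurj))), by simp, ?_⟩
        funext i
        exact hs i
      simp [UniformHypergraph.adjacency, this]
  rw [← key, Fintype.sum_prod_type]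
  refine Finset.sum_congr rfl fun j _ => ?_
  have (s : Equiv.Perm (Fin 3)) :
      (C ((looseHyperpath 3 n).adjacency (e (j, s))) * ∏ i, X (e (j, s) i) :
        MvPolynomial (Fin ((3 - 1) * n + 1)) ℂ) =
      C (1 / 2) * ∏ i, X (looseHyperpathVertex 3 n j i) := by
    rw [UniformHypergraph.adjacency, if_pos (hmem _)]
    congr 1
    exact Equiv.prod_comp s fun i => X (looseHyperpathVertex 3 n j i)
  rw [Finset.sum_congr rfl fun s _ => this s, Finset.sum_const, Finset.card_univ, Fintype.card_perm,
    nsmul_eq_mul, ← mul_assoc]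
  congr 1
  rw [← map_natCast (C (σ := Fin ((3 - 1) * n + 1)) (R := ℂ)), ← C_mul]
  norm_num [Nat.factorial]

/-- The coordinates at the vertices of even index, extended by zero. -/
def evenCoord {R : Type*} [Zero R] {n : ℕ} (x : Fin ((3 - 1) * n + 1) → R) (j : ℕ) : R :=
  if h : 2 * j < (3 - 1) * n + 1 then x ⟨2 * j, h⟩ else 0

/-- The coordinates at the vertices of odd index, extended by zero. -/
def oddCoord {R : Type*} [Zero R] {n : ℕ} (x : Fin ((3 - 1) * n + 1) → R) (j : ℕ) : R :=
  if h : 2 * j + 1 < (3 - 1) * n + 1 then x ⟨2 * j + 1, h⟩ else 0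

/-- The equations of the nullvariety of the loose hyperpath, in terms of the coordinates `y` at the
vertices of even index and the coordinates `z` at the vertices of odd index. -/
structure IsLoosePathNull {R : Type*} [CommRing R] (n : ℕ) (y z : ℕ → R) : Prop where
  even_eq_zero : ∀ j, n < j → y j = 0
  odd_eq_zero : ∀ j, n ≤ j → z j = 0
  -- These are the derivatives at vertices `2j + 1`, `0` and `2j + 2`. At the last vertex `2n`, the
  -- extension by zero kills the second term of `rel`.
  mul_succ : ∀ j, y j * y (j + 1) = 0
  first : z 0 * y 1 = 0
  rel : ∀ j, y j * z j + z (j + 1) * y (j + 2) = 0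

theorem aeval_pderiv_form {R : Type*} [CommRing R] [Algebra ℂ R] {n : ℕ}
    (x : Fin ((3 - 1) * n + 1) → R) (v : Fin ((3 - 1) * n + 1)) :
    aeval x (pderiv v (Hypermatrix.form
      ((looseHyperpath 3 n).adjacency - (0 : ℂ) • Hypermatrix.ident _ 3))) =
      3 * ∑ j ∈ Finset.range n,
        ((if v = 2 * j then oddCoord x j * evenCoord x (j + 1) else 0) +
        (if v = 2 * j + 1 then evenCoord x j * evenCoord x (j + 1) else 0) +
        (if v = 2 * j + 2 then evenCoord x j * oddCoord x j else 0)) := by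
  rw [form_looseHyperpath, map_sum, map_sum, Finset.mul_sum, ← Fin.sum_univ_eq_sum_range (fun j =>
    3 * ((if v = 2 * j then oddCoord x j * evenCoord x (j + 1) else 0) +
        (if v = 2 * j + 1 then evenCoord x j * evenCoord x (j + 1) else 0) +
        (if v = 2 * j + 2 then evenCoord x j * oddCoord x j else 0)))]
  refine Finset.sum_congr rfl fun j _ => ?_
  have hj := j.isLt
  have h0 : evenCoord x j = x (looseHyperpathVertex 3 n j 0) := by
    rw [evenCoord, dif_pos (by omega)]; rfl
  have h1 : oddCoord x j = x (looseHyperpathVertex 3 n j 1) := by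
    rw [oddCoord, dif_pos (by omega)]; rfl
  have h2 : evenCoord x (j + 1) = x (looseHyperpathVertex 3 n j 2) := by
    rw [evenCoord, dif_pos (by omega)]; rfl
  have e0 : (v : ℕ) = 2 * j ↔ looseHyperpathVertex 3 n j 0 = v := by
    rw [Fin.ext_iff]; simp [looseHyperpathVertex, eq_comm]
  have e1 : (v : ℕ) = 2 * j + 1 ↔ looseHyperpathVertex 3 n j 1 = v := by
    rw [Fin.ext_iff]; simp [looseHyperpathVertex, eq_comm]
  have e2 : (v : ℕ) = 2 * j + 2 ↔ looseHyperpathVertex 3 n j 2 = v := by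
    rw [Fin.ext_iff]; simp [looseHyperpathVertex, eq_comm]
  have hC : aeval x (C 3 : MvPolynomial (Fin ((3 - 1) * n + 1)) ℂ) = (3 : R) := by
    rw [aeval_C]; exact map_ofNat _ 3
  simp only [e0, e1, e2, h0, h1, h2, Fin.prod_univ_three, map_mul, hC, smul_eq_mul,
    Derivation.leibniz, pderiv_X, Pi.single_apply, map_add, aeval_X, apply_ite (aeval x), map_one,
    map_zero]
  split_ifs <;> simp <;> ring

/-- Any `ℂ`-algebra is allowed, so that this serves both for complex points and for generic points
of components. -/
theorem forall_aeval_pderiv_form_iff {R : Type*} [CommRing R] [Algebra ℂ R] {n : ℕ}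
    (x : Fin ((3 - 1) * n + 1) → R) :
    (∀ v, aeval x (pderiv v (Hypermatrix.form
      ((looseHyperpath 3 n).adjacency - (0 : ℂ) • Hypermatrix.ident _ 3))) = 0) ↔
      IsLoosePathNull n (evenCoord x) (oddCoord x) := by
  have h3 : IsUnit (3 : R) := by
    have := (IsUnit.mk0 (3 : ℂ) (by norm_num)).map (algebraMap ℂ R)
    rwa [map_ofNat] at this
  have hy (j : ℕ) (hj : n < j) : evenCoord x j = 0 := dif_neg (by omega)
  have hz (j : ℕ) (hj : n ≤ j) : oddCoord x j = 0 := dif_neg (by omega)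
  simp only [aeval_pderiv_form, h3.mul_right_eq_zero]
  have hodd (k : ℕ) : ∑ j ∈ Finset.range n,
        ((if 2 * k + 1 = 2 * j then oddCoord x j * evenCoord x (j + 1) else 0) +
        (if 2 * k + 1 = 2 * j + 1 then evenCoord x j * evenCoord x (j + 1) else 0) +
        (if 2 * k + 1 = 2 * j + 2 then evenCoord x j * oddCoord x j else 0)) =
        evenCoord x k * evenCoord x (k + 1) := by
    have (j : ℕ) : ((if 2 * k + 1 = 2 * j then oddCoord x j * evenCoord x (j + 1) else 0) +
        (if 2 * k + 1 = 2 * j + 1 then evenCoord x j * evenCoord x (j + 1) else 0) +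
        (if 2 * k + 1 = 2 * j + 2 then evenCoord x j * oddCoord x j else 0)) =
        if k = j then evenCoord x j * evenCoord x (j + 1) else 0 := by
      rw [if_neg (by omega), if_neg (by omega : ¬ 2 * k + 1 = 2 * j + 2)]
      simp
    simp only [this, Finset.sum_ite_eq, Finset.mem_range]
    split_ifs with h
    · rfl
    · rw [hy (k + 1) (by omega), mul_zero]
  have hzero : ∑ j ∈ Finset.range n,
        ((if 0 = 2 * j then oddCoord x j * evenCoord x (j + 1) else 0) +
        (if 0 = 2 * j + 1 then evenCoord x j * evenCoord x (j + 1) else 0) +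
        (if 0 = 2 * j + 2 then evenCoord x j * oddCoord x j else 0)) =
        oddCoord x 0 * evenCoord x 1 := by
    have (j : ℕ) : ((if 0 = 2 * j then oddCoord x j * evenCoord x (j + 1) else 0) +
        (if 0 = 2 * j + 1 then evenCoord x j * evenCoord x (j + 1) else 0) +
        (if 0 = 2 * j + 2 then evenCoord x j * oddCoord x j else 0)) =
        if 0 = j then oddCoord x j * evenCoord x (j + 1) else 0 := by
      rw [if_neg (by omega : ¬ 0 = 2 * j + 1), if_neg (by omega : ¬ 0 = 2 * j + 2)]
      simp [eq_comm]
    simp only [this, Finset.sum_ite_eq, Finset.mem_range]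
    split_ifs with h
    · rfl
    · rw [hz 0 (by omega), zero_mul]
  have hsucc (k : ℕ) : ∑ j ∈ Finset.range n,
        ((if 2 * (k + 1) = 2 * j then oddCoord x j * evenCoord x (j + 1) else 0) +
        (if 2 * (k + 1) = 2 * j + 1 then evenCoord x j * evenCoord x (j + 1) else 0) +
        (if 2 * (k + 1) = 2 * j + 2 then evenCoord x j * oddCoord x j else 0)) =
        evenCoord x k * oddCoord x k + oddCoord x (k + 1) * evenCoord x (k + 2) := by
    have (j : ℕ) : ((if 2 * (k + 1) = 2 * j then oddCoord x j * evenCoord x (j + 1) else 0) +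
        (if 2 * (k + 1) = 2 * j + 1 then evenCoord x j * evenCoord x (j + 1) else 0) +
        (if 2 * (k + 1) = 2 * j + 2 then evenCoord x j * oddCoord x j else 0)) =
        (if k + 1 = j then oddCoord x j * evenCoord x (j + 1) else 0) +
        (if k = j then evenCoord x j * oddCoord x j else 0) := by
      rw [if_neg (by omega : ¬ 2 * (k + 1) = 2 * j + 1), add_zero]
      congr 1
      · exact if_congr (by omega) rfl rfl
      · exact if_congr (by omega) rfl rfl
    simp only [this, Finset.sum_add_distrib, Finset.sum_ite_eq, Finset.mem_range]
    rw [add_comm]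
    congr 1
    · split_ifs with h
      · rfl
      · rw [hz k (by omega), mul_zero]
    · split_ifs with h
      · rfl
      · rw [hz (k + 1) (by omega), zero_mul]
  constructor
  · intro h
    refine ⟨hy, hz, fun j => ?_, ?_, fun j => ?_⟩
    · by_cases hj : j < n
      · rw [← hodd]
        exact h ⟨2 * j + 1, by omega⟩
      · rw [hy (j + 1) (by omega), mul_zero]
    · rw [← hzero]
      exact h ⟨0, by omega⟩
    · by_cases hj : j < n
      · rw [← hsucc]
        exact h ⟨2 * (j + 1), by omega⟩
      · rw [hz j (by omega), hz (j + 1) (by omega), mul_zero, zero_mul, add_zero]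
  · rintro h ⟨v, hv⟩
    dsimp only
    obtain ⟨k, rfl | rfl⟩ := Nat.even_or_odd' v
    · cases k with
      | zero => exact hzero.trans h.first
      | succ k => exact (hsucc k).trans (h.rel k)
    · exact (hodd k).trans (h.mul_succ k)

/-! ### Upper bound: the support of `y` and its neighbours -/

theorem IsLoosePathNull.rel_of_pos {R : Type*} [CommRing R] {n : ℕ} {y z : ℕ → R}
    (h : IsLoosePathNull n y z) {j : ℕ} (hj : j = 0 ∨ y (j - 1) = 0) : z j * y (j + 1) = 0 := by
  cases j with
  | zero => exact h.first
  | succ j =>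
    have hj' : y j = 0 := hj.resolve_left (Nat.succ_ne_zero j)
    simpa [hj'] using h.rel j

/-- In a domain, all coordinates of a solution of the equations are algebraic over the nonzero
coordinates of even index together with the coordinates of odd index, where one of the latter is
dropped for each neighbour of the support of `y`. -/
theorem IsLoosePathNull.exists_finset_isAlgebraic {R : Type*} [CommRing R] [IsDomain R]
    [Algebra ℂ R] {n : ℕ} {y z : ℕ → R} (h : IsLoosePathNull n y z) :
    ∃ s : Finset R, s.card ≤ 2 * (n / 2) + 1 ∧
      ∀ j, IsAlgebraic (Algebra.adjoin ℂ (s : Set R)) (y j) ∧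
        IsAlgebraic (Algebra.adjoin ℂ (s : Set R)) (z j) := by
  classical
  have hy_le {j : ℕ} (hj : y j ≠ 0) : j ≤ n := by
    by_contra hlt
    exact hj (h.even_eq_zero j (by omega))
  have hindep {j : ℕ} (hj : y j ≠ 0) : y (j + 1) = 0 :=
    (mul_eq_zero.1 (h.mul_succ j)).resolve_left hj
  let S := (Finset.range (n + 1)).filter fun j => y j ≠ 0
  let N := (Finset.range (n + 1)).filter fun j => y (j + 1) ≠ 0 ∨ (1 ≤ j ∧ y (j - 1) ≠ 0)
  have hS {j : ℕ} : j ∈ S ↔ y j ≠ 0 := by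
    simp only [S, Finset.mem_filter, Finset.mem_range]
    exact ⟨fun hj => hj.2, fun hj => ⟨by have := hy_le hj; omega, hj⟩⟩
  have hN {j : ℕ} : j ∈ N ↔ j ≤ n ∧ (y (j + 1) ≠ 0 ∨ (1 ≤ j ∧ y (j - 1) ≠ 0)) := by
    simp [N]
  -- Each neighbour of `S` selects an edge joining it to `S`, the left one if possible; the `z` of
  -- that edge is dropped. No edge is selected from both ends, since `S` is independent.
  let e : ℕ → ℕ := fun j => if 1 ≤ j ∧ y (j - 1) ≠ 0 then j - 1 else j
  have he_pos {j : ℕ} (hj : 1 ≤ j ∧ y (j - 1) ≠ 0) : e j = j - 1 := if_pos hj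
  have he_neg {j : ℕ} (hj : ¬ (1 ≤ j ∧ y (j - 1) ≠ 0)) : e j = j := if_neg hj
  have he_lt {j : ℕ} (hj : j ∈ N) : e j < n := by
    obtain ⟨hjn, hj⟩ := hN.1 hj
    by_cases hc : 1 ≤ j ∧ y (j - 1) ≠ 0
    · rw [he_pos hc]; omega
    · rw [he_neg hc]
      have := hy_le (hj.resolve_right hc)
      omega
  have he_inj_aux {i j : ℕ} (hi : i ∈ N) (hij : e i = e j) (hjc : 1 ≤ j ∧ y (j - 1) ≠ 0)
      (hic : ¬ (1 ≤ i ∧ y (i - 1) ≠ 0)) : False := by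
    rw [he_pos hjc, he_neg hic] at hij
    subst hij
    exact (hN.1 hi).2.elim (fun h' => h' (hindep hjc.2)) hic
  have he_inj : Set.InjOn e N := by
    intro i hi j hj hij
    by_cases hic : 1 ≤ i ∧ y (i - 1) ≠ 0 <;> by_cases hjc : 1 ≤ j ∧ y (j - 1) ≠ 0
    · rw [he_pos hic, he_pos hjc] at hij
      omega
    · exact (he_inj_aux hj hij.symm hic hjc).elim
    · exact (he_inj_aux hi hij hjc hic).elim
    · rwa [he_neg hic, he_neg hjc] at hij
  let T := Finset.range n \ N.image e
  have hsub : N.image e ⊆ Finset.range n := by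
    intro i hi
    obtain ⟨j, hj, rfl⟩ := Finset.mem_image.1 hi
    exact Finset.mem_range.2 (he_lt hj)
  have hTcard : T.card + N.card = n := by
    have := Finset.card_sdiff_add_card_eq_card hsub
    rwa [Finset.card_image_of_injOn he_inj, Finset.card_range] at this
  -- For even `n` the matching `{1,2}, {3,4}, …` misses only 0; for odd `n` the matching `{0,1},
  -- {2,3}, …` is perfect. Partners of elements of `S` lie in `N`.
  have hScard : S.card + n ≤ N.card + (2 * (n / 2) + 1) := by
    obtain ⟨m, hm | hm⟩ := Nat.even_or_odd' n
    · have : (S.erase 0).card ≤ N.card := by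
        refine Finset.card_le_card_of_injOn (fun j => if Even j then j - 1 else j + 1) ?_ ?_
        · intro j hj
          obtain ⟨hj0, hjS⟩ := Finset.mem_erase.1 hj
          have hj' := hS.1 hjS
          have := hy_le hj'
          refine hN.2 ?_
          dsimp only
          split_ifs with hev
          · exact ⟨by omega, Or.inl (by rwa [Nat.sub_add_cancel (by omega)])⟩
          · rw [Nat.even_iff] at hev
            exact ⟨by omega, Or.inr ⟨by omega, hj'⟩⟩
        · intro i hi j hj hij
          have hi0 := (Finset.mem_erase.1 hi).1
          have hj0 := (Finset.mem_erase.1 hj).1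
          simp only [Nat.even_iff] at hij
          split_ifs at hij <;> omega
      have h2 := Finset.pred_card_le_card_erase (s := S) (a := 0)
      omega
    · have : S.card ≤ N.card := by
        refine Finset.card_le_card_of_injOn (fun j => if Even j then j + 1 else j - 1) ?_ ?_
        · intro j hj
          have hj' := hS.1 hj
          have := hy_le hj'
          refine hN.2 ?_
          dsimp only
          split_ifs with hev
          · rw [Nat.even_iff] at hev
            exact ⟨by omega, Or.inr ⟨by omega, hj'⟩⟩
          · rw [Nat.even_iff] at hev
            exact ⟨by omega, Or.inl (by rwa [Nat.sub_add_cancel (by omega)])⟩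
        · intro i hi j hj hij
          simp only [Nat.even_iff] at hij
          split_ifs at hij <;> omega
      omega
  have halg {s : Finset R} {a : R} (ha : a ∈ s) : IsAlgebraic (Algebra.adjoin ℂ (s : Set R)) a :=
    isAlgebraic_algebraMap (⟨a, Algebra.subset_adjoin ha⟩ : Algebra.adjoin ℂ (s : Set R))
  have hyalg (j : ℕ) :
      IsAlgebraic (Algebra.adjoin ℂ ((S.image y ∪ T.image z : Finset R) : Set R)) (y j) := by
    by_cases hj : y j = 0
    · rw [hj]; exact isAlgebraic_zero
    · exact halg (Finset.mem_union_left _ (Finset.mem_image_of_mem y (hS.2 hj)))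
  have hzalg {j : ℕ} (hj : j ∉ N.image e) :
      IsAlgebraic (Algebra.adjoin ℂ ((S.image y ∪ T.image z : Finset R) : Set R)) (z j) := by
    by_cases hjn : j < n
    · exact halg (Finset.mem_union_right _ (Finset.mem_image_of_mem z
        (Finset.mem_sdiff.2 ⟨Finset.mem_range.2 hjn, hj⟩)))
    · rw [h.odd_eq_zero j (by omega)]; exact isAlgebraic_zero
  refine ⟨S.image y ∪ T.image z, ?_, fun j => ⟨hyalg j, ?_⟩⟩
  · have h1 := Finset.card_union_le (S.image y) (T.image z)
    have h2 := Finset.card_image_le (s := S) (f := y)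
    have h3 := Finset.card_image_le (s := T) (f := z)
    omega
  · by_cases hj : j ∈ N.image e
    · obtain ⟨i, hi, rfl⟩ := Finset.mem_image.1 hj
      by_cases hc : 1 ≤ i ∧ y (i - 1) ≠ 0
      · rw [he_pos hc]
        obtain ⟨i, rfl⟩ := Nat.exists_eq_add_of_le' hc.1
        rw [Nat.add_sub_cancel] at hc ⊢
        refine IsAlgebraic.of_mul (mem_nonZeroDivisors_of_ne_zero hc.2) (hyalg i) ?_
        -- Solve for the dropped `z i`. If `y (i + 2)` is nonzero, `z (i + 1)` was kept: `i + 1`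
        -- selected edge `i`, and edge `i + 1` could otherwise be selected only by `i + 2`, which
        -- would need `y (i + 1) ≠ 0`.
        rw [eq_neg_of_add_eq_zero_left (h.rel i)]
        refine IsAlgebraic.neg ?_
        by_cases hy2 : y (i + 2) = 0
        · rw [hy2, mul_zero]; exact isAlgebraic_zero
        · refine IsAlgebraic.mul (hzalg ?_) (hyalg _)
          intro hmem
          obtain ⟨k, hk, hke⟩ := Finset.mem_image.1 hmem
          by_cases hkc : 1 ≤ k ∧ y (k - 1) ≠ 0
          · rw [he_pos hkc] at hke
            rw [hke] at hkc
            exact hkc.2 (hindep hc.2)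
          · rw [he_neg hkc] at hke
            subst hke
            exact hkc ⟨by omega, hc.2⟩
      · rw [he_neg hc]
        -- With no support on the left, the relation is a monomial and forces `z i = 0`.
        have hzi := h.rel_of_pos (j := i) (by
          by_contra hcon
          push Not at hcon
          exact hc ⟨by omega, hcon.2⟩)
        rw [(mul_eq_zero.1 hzi).resolve_right ((hN.1 hi).2.resolve_right hc)]
        exact isAlgebraic_zero
    · exact hzalg hj

theorem mem_nullvariety_looseHyperpath_iff {n : ℕ} (x : Fin ((3 - 1) * n + 1) → ℂ) :
    x ∈ (looseHyperpath 3 n).nullvariety ↔ IsLoosePathNull n (evenCoord x) (oddCoord x) := by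
  rw [← forall_aeval_pderiv_form_iff]
  rfl

theorem evenCoord_half {R : Type*} [Zero R] {n : ℕ} (x : Fin ((3 - 1) * n + 1) → R)
    {v : Fin ((3 - 1) * n + 1)} (hv : (v : ℕ) % 2 = 0) : evenCoord x (v / 2) = x v := by
  have : 2 * ((v : ℕ) / 2) = v := by omega
  rw [evenCoord, dif_pos (by omega)]
  congr 1
  exact Fin.ext this

theorem oddCoord_half {R : Type*} [Zero R] {n : ℕ} (x : Fin ((3 - 1) * n + 1) → R)
    {v : Fin ((3 - 1) * n + 1)} (hv : (v : ℕ) % 2 = 1) : oddCoord x (v / 2) = x v := by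
  have : 2 * ((v : ℕ) / 2) + 1 = v := by omega
  rw [oddCoord, dif_pos (by omega)]
  congr 1
  exact Fin.ext this

theorem affineDim_nullvariety_looseHyperpath_le (n : ℕ) :
    affineDim (looseHyperpath 3 n).nullvariety ≤ ((2 * (n / 2) + 1 : ℕ) : WithBot ℕ∞) := by
  refine affineDim_le _ _ fun R _ _ _ x hx => ?_
  have hnull : IsLoosePathNull n (evenCoord x) (oddCoord x) := by
    rw [← forall_aeval_pderiv_form_iff]
    intro v
    refine hx _ (mem_vanishingIdeal_iff.2 fun w hw => ?_)
    exact hw v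
  obtain ⟨s, hs, halg⟩ := hnull.exists_finset_isAlgebraic
  refine ⟨s, hs, fun v => ?_⟩
  rcases Nat.mod_two_eq_zero_or_one v with hv | hv
  · rw [← evenCoord_half x hv]
    exact (halg _).1
  · rw [← oddCoord_half x hv]
    exact (halg _).2

/-! ### Lower bound: explicit parametrisations -/

theorem IsLoosePathNull.map {R S : Type*} [CommRing R] [CommRing S] {n : ℕ} {y z : ℕ → R}
    (h : IsLoosePathNull n y z) (f : R →+* S) :
    IsLoosePathNull n (fun j => f (y j)) (fun j => f (z j)) where
  even_eq_zero j hj := by rw [h.even_eq_zero j hj, map_zero]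
  odd_eq_zero j hj := by rw [h.odd_eq_zero j hj, map_zero]
  mul_succ j := by rw [← map_mul, h.mul_succ, map_zero]
  first := by rw [← map_mul, h.first, map_zero]
  rel j := by rw [← map_mul, ← map_mul, ← map_add, h.rel, map_zero]

/-- A polynomial parametrisation of a part of the nullvariety bounds its dimension from below. -/
theorem IsLoosePathNull.natCard_le_affineDim {n : ℕ} {σ : Type} [Finite σ]
    {y z : ℕ → MvPolynomial σ ℂ} (h : IsLoosePathNull n y z)
    (halg : ∀ A : Subalgebra ℂ (MvPolynomial σ ℂ), (∀ j, y j ∈ A) → (∀ j, z j ∈ A) →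
      ∀ s, IsAlgebraic A (X s : MvPolynomial σ ℂ)) :
    (Nat.card σ : WithBot ℕ∞) ≤ affineDim (looseHyperpath 3 n).nullvariety := by
  let x : Fin ((3 - 1) * n + 1) → MvPolynomial σ ℂ :=
    fun v => if (v : ℕ) % 2 = 0 then y (v / 2) else z (v / 2)
  have hy : evenCoord x = y := by
    funext j
    by_cases hj : 2 * j < (3 - 1) * n + 1
    · simp [evenCoord, hj, x]
    · rw [evenCoord, dif_neg hj, h.even_eq_zero j (by omega)]
  have hz : oddCoord x = z := by
    funext j
    by_cases hj : 2 * j + 1 < (3 - 1) * n + 1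
    · have h1 : (2 * j + 1) % 2 ≠ 0 := by omega
      have h2 : (2 * j + 1) / 2 = j := by omega
      rw [oddCoord, dif_pos hj]
      simp only [x]
      rw [if_neg h1, h2]
    · rw [oddCoord, dif_neg hj, h.odd_eq_zero j (by omega)]
  have hx (v) : x v ∈ (aeval (R := ℂ) x).range := ⟨X v, aeval_X x v⟩
  refine _root_.natCard_le_affineDim _ x (fun w => ?_) (halg _ (fun j => ?_) fun j => ?_)
  · rw [mem_nullvariety_looseHyperpath_iff]
    convert h.map (eval w) using 1
    · funext j
      rw [← hy]
      by_cases hj : 2 * j < (3 - 1) * n + 1 <;> simp [evenCoord, hj]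
    · funext j
      rw [← hz]
      by_cases hj : 2 * j + 1 < (3 - 1) * n + 1 <;> simp [oddCoord, hj]
  · rw [← hy, evenCoord]
    split_ifs
    · exact hx _
    · exact zero_mem _
  · rw [← hz, oddCoord]
    split_ifs
    · exact hx _
    · exact zero_mem _

theorem isAlgebraic_of_mem_subalgebra {R A : Type*} [Field R] [CommRing A] [IsDomain A]
    [Algebra R A] {B : Subalgebra R A} {a : A} (ha : a ∈ B) : IsAlgebraic B a :=
  isAlgebraic_algebraMap (⟨a, ha⟩ : B)

/-- When `y = 0` every equation holds and the `n` coordinates `z` are free. -/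
theorem natCast_le_affineDim_nullvariety_looseHyperpath (n : ℕ) :
    (n : WithBot ℕ∞) ≤ affineDim (looseHyperpath 3 n).nullvariety := by
  let z : ℕ → MvPolynomial (Fin n) ℂ := fun j => if h : j < n then X ⟨j, h⟩ else 0
  have h : IsLoosePathNull n (fun _ => 0) z :=
    ⟨by simp, fun j hj => dif_neg (by omega), by simp, by simp, by simp⟩
  have := h.natCard_le_affineDim fun A _ hz s => isAlgebraic_of_mem_subalgebra (by
    have := hz s
    rwa [show z s = X s from dif_pos s.isLt] at this)
  simpa using this

/-- Let `y` be free at the `m + 1` even indices and zero elsewhere. What remains is one relation for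
each pair `z (2i), z (2i + 1)`, solved by the multiples `T i` of `(Y (i + 1), -Y i)`: `m` further
parameters. -/
theorem natCast_le_affineDim_nullvariety_looseHyperpath_two_mul (m : ℕ) :
    ((2 * m + 1 : ℕ) : WithBot ℕ∞) ≤ affineDim (looseHyperpath 3 (2 * m)).nullvariety := by
  let Y : ℕ → MvPolynomial (Fin (m + 1) ⊕ Fin m) ℂ :=
    fun j => if h : j < m + 1 then X (Sum.inl ⟨j, h⟩) else 0
  let T : ℕ → MvPolynomial (Fin (m + 1) ⊕ Fin m) ℂ :=
    fun j => if h : j < m then X (Sum.inr ⟨j, h⟩) else 0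
  have hY (j : ℕ) (hj : m < j) : Y j = 0 := dif_neg (by omega)
  have hT (j : ℕ) (hj : m ≤ j) : T j = 0 := dif_neg (by omega)
  let y : ℕ → MvPolynomial (Fin (m + 1) ⊕ Fin m) ℂ :=
    fun j => if j % 2 = 0 then Y (j / 2) else 0
  let z : ℕ → MvPolynomial (Fin (m + 1) ⊕ Fin m) ℂ :=
    fun j => if j % 2 = 0 then T (j / 2) * Y (j / 2 + 1) else -(T (j / 2) * Y (j / 2))
  have hy_odd (j : ℕ) (hj : j % 2 ≠ 0) : y j = 0 := if_neg hj
  have hy_even (i : ℕ) : y (2 * i) = Y i := by simp [y]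
  have hz_even (i : ℕ) : z (2 * i) = T i * Y (i + 1) := by simp [z]
  have hz_odd (i : ℕ) : z (2 * i + 1) = -(T i * Y i) := by
    have h1 : (2 * i + 1) % 2 ≠ 0 := by omega
    have h2 : (2 * i + 1) / 2 = i := by omega
    simp only [z]
    rw [if_neg h1, h2]
  have h : IsLoosePathNull (2 * m) y z := by
    refine ⟨fun j hj => ?_, fun j hj => ?_, fun j => ?_, ?_, fun j => ?_⟩
    · obtain ⟨i, rfl | rfl⟩ := Nat.even_or_odd' j
      · rw [hy_even, hY i (by omega)]
      · exact hy_odd _ (by omega)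
    · obtain ⟨i, rfl | rfl⟩ := Nat.even_or_odd' j
      · rw [hz_even, hT i (by omega), zero_mul]
      · rw [hz_odd, hT i (by omega), zero_mul, neg_zero]
    · by_cases hj : j % 2 = 0
      · rw [hy_odd (j + 1) (by omega), mul_zero]
      · rw [hy_odd j hj, zero_mul]
    · rw [hy_odd 1 (by omega), mul_zero]
    · obtain ⟨i, rfl | rfl⟩ := Nat.even_or_odd' j
      · rw [hz_even, hz_odd, hy_even, show 2 * i + 2 = 2 * (i + 1) by ring, hy_even]
        ring
      · rw [hy_odd (2 * i + 1) (by omega), hy_odd (2 * i + 1 + 2) (by omega), zero_mul, mul_zero,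
          add_zero]
  have := h.natCard_le_affineDim fun A hyA hzA s => by
    have hYA (i : ℕ) : Y i ∈ A := hy_even i ▸ hyA (2 * i)
    rcases s with i | i
    · have := hYA i
      rw [show Y i = X (Sum.inl i) from dif_pos i.isLt] at this
      exact isAlgebraic_of_mem_subalgebra this
    · have h1 : T i = X (Sum.inr i) := dif_pos i.isLt
      have h2 : Y (i + 1) = X (Sum.inl i.succ) := dif_pos i.succ.isLt
      -- `T i` is recovered as the quotient of `z (2i)` by `Y (i + 1)`.
      refine IsAlgebraic.of_mul (y := Y (i + 1)) ?_ (isAlgebraic_of_mem_subalgebra (hYA _)) ?_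
      · rw [h2]
        exact mem_nonZeroDivisors_of_ne_zero (X_ne_zero _)
      · rw [← h1, mul_comm, ← hz_even]
        exact isAlgebraic_of_mem_subalgebra (hzA _)
  refine le_trans (le_of_eq ?_) this
  rw [Nat.card_sum, Nat.card_fin, Nat.card_fin]
  congr 1
  ring

theorem mainTheorem4 (n : ℕ) (hn : 3 ≤ n) :
    affineDim (looseHyperpath 3 n).nullvariety = ((2 * (n / 2) + 1 : ℕ) : WithBot ℕ∞) := by
  refine le_antisymm (affineDim_nullvariety_looseHyperpath_le n) ?_
  obtain ⟨m, rfl | rfl⟩ := Nat.even_or_odd' n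
  · rw [Nat.mul_div_cancel_left m two_pos]
    exact natCast_le_affineDim_nullvariety_looseHyperpath_two_mul m
  · rw [show (2 * m + 1) / 2 = m by omega]
    exact natCast_le_affineDim_nullvariety_looseHyperpath (2 * m + 1)
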